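/- For $n \in \{0,1,2,\ldots\}$ let $H_n = \sum_{j=1}^{n} \frac1j$ denote the $n$-th harmonic number (so $H_0 = 0$). Then the following series converges, and $$\sum_{k=1}^{\infty} \frac{16^k\,(6k-1)\,\bigl(4H_{2k-1} - H_{k-1}\bigr)}{(2k-1)\,k^2\,\binom{2k}{k}\binom{4k}{2k}} = \pi^3 .$$ -/

import Mathlib

open Finset Filter Topology

/-! WZ method. The pair F = `wzTerm`, G = `wzMate` satisfies F(n,k) - F(n,k+1) = G(n,k) - G(n+1,k)
(`wzTerm_sub_wzTerm`). Summing over the square n, k < N leaves only its four sides. The sides ∑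
F(n,N) and ∑ G(N,k) tend to 0, so ∑ G(0,k) = ∑ F(n,0). The right side is 4β(3) = π³/8, with β the
Dirichlet beta function; G(0,k) is one eighth of the term of index k+1 in the stated series. -/

/-- The shifted factorial `(1/2)_n`. -/
noncomputable def halfPoch (n : ℕ) : ℝ := ∏ i ∈ range n, ((i : ℝ) + 1 / 2)

/-- The shifted factorial `(3/2)_n`. -/
noncomputable def threeHalvesPoch (n : ℕ) : ℝ := ∏ i ∈ range n, ((i : ℝ) + 3 / 2)

/-- The sum of the reciprocals of the first `n` odd numbers. -/
noncomputable def oddHarmonic (n : ℕ) : ℝ := ∑ i ∈ range n, 1 / (2 * (i : ℝ) + 1)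

noncomputable def wzWeight (n k : ℕ) : ℝ :=
  (k.factorial : ℝ) ^ 2 * halfPoch n / threeHalvesPoch (n + 2 * k)

noncomputable def wzHarmonic (n k : ℕ) : ℝ :=
  4 * (oddHarmonic (n + k + 1) - oddHarmonic n) + ((harmonic k : ℚ) : ℝ)

/-- The summand of the WZ pair, differentiated along its parameter. -/
noncomputable def wzTerm (n k : ℕ) : ℝ :=
  (-1) ^ n * wzWeight n k / (2 * n + 2 * k + 1) * wzHarmonic n k

noncomputable def wzRatio (n k : ℕ) : ℝ :=
  (2 * n + 6 * k + 5) / (2 * (2 * n + 4 * k + 3))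

/-- The companion of `wzTerm` in the WZ pair. -/
noncomputable def wzMate (n k : ℕ) : ℝ := wzRatio n k * wzTerm n k

/-! ### Recurrences in `n` and `k` -/

lemma halfPoch_succ (n : ℕ) : halfPoch (n + 1) = halfPoch n * (n + 1 / 2) :=
  prod_range_succ _ _

lemma threeHalvesPoch_succ (n : ℕ) :
    threeHalvesPoch (n + 1) = threeHalvesPoch n * (n + 3 / 2) :=
  prod_range_succ _ _

lemma halfPoch_pos (n : ℕ) : 0 < halfPoch n := prod_pos fun _ _ => by positivity

lemma threeHalvesPoch_pos (n : ℕ) : 0 < threeHalvesPoch n := prod_pos fun _ _ => by positivity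

lemma halfPoch_succ_eq_threeHalvesPoch (n : ℕ) : halfPoch (n + 1) = threeHalvesPoch n / 2 := by
  rw [halfPoch, prod_range_succ', threeHalvesPoch]
  have : ∀ i : ℕ, ((i + 1 : ℕ) : ℝ) + 1 / 2 = i + 3 / 2 := fun i => by push_cast; ring
  simp only [this]
  norm_num
  ring

lemma oddHarmonic_succ (n : ℕ) : oddHarmonic (n + 1) = oddHarmonic n + 1 / (2 * n + 1) :=
  sum_range_succ _ _

lemma wzWeight_pos (n k : ℕ) : 0 < wzWeight n k := by
  have := halfPoch_pos n
  have := threeHalvesPoch_pos (n + 2 * k)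
  unfold wzWeight
  positivity

lemma wzWeight_succ_left (n k : ℕ) :
    wzWeight (n + 1) k = wzWeight n k * ((2 * n + 1) / (2 * n + 4 * k + 3)) := by
  have := (threeHalvesPoch_pos (n + 2 * k)).ne'
  rw [wzWeight, wzWeight, show n + 1 + 2 * k = n + 2 * k + 1 by ring, threeHalvesPoch_succ,
    halfPoch_succ]
  push_cast
  field_simp
  ring

lemma wzWeight_succ_right (n k : ℕ) :
    wzWeight n (k + 1) =
      wzWeight n k * (4 * (k + 1) ^ 2 / ((2 * n + 4 * k + 3) * (2 * n + 4 * k + 5))) := by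
  have := (threeHalvesPoch_pos (n + 2 * k)).ne'
  rw [wzWeight, wzWeight, show n + 2 * (k + 1) = n + 2 * k + 1 + 1 by ring, threeHalvesPoch_succ,
    threeHalvesPoch_succ, Nat.factorial_succ]
  push_cast
  field_simp
  ring

lemma wzHarmonic_succ_left (n k : ℕ) :
    wzHarmonic (n + 1) k =
      wzHarmonic n k + (4 / (2 * n + 2 * k + 3) - 4 / (2 * n + 1)) := by
  rw [wzHarmonic, wzHarmonic, show n + 1 + k + 1 = n + k + 1 + 1 by ring,
    oddHarmonic_succ (n + k + 1), oddHarmonic_succ n]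
  push_cast
  rw [show 2 * ((n : ℝ) + k + 1) + 1 = 2 * n + 2 * k + 3 by ring]
  ring

lemma wzHarmonic_succ_right (n k : ℕ) :
    wzHarmonic n (k + 1) = wzHarmonic n k + (4 / (2 * n + 2 * k + 3) + 1 / (k + 1)) := by
  rw [wzHarmonic, wzHarmonic, show n + (k + 1) + 1 = n + k + 1 + 1 by ring,
    oddHarmonic_succ (n + k + 1), harmonic_succ]
  push_cast
  rw [show 2 * ((n : ℝ) + k + 1) + 1 = 2 * n + 2 * k + 3 by ring]
  ring

/-! ### The WZ identity and its sum over a rectangle -/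

lemma wzTerm_sub_wzTerm (n k : ℕ) :
    wzTerm n k - wzTerm n (k + 1) = wzMate n k - wzMate (n + 1) k := by
  simp only [wzMate, wzRatio, wzTerm, wzHarmonic_succ_left, wzHarmonic_succ_right,
    wzWeight_succ_left, wzWeight_succ_right, pow_succ]
  -- What remains is a rational function identity, affine in `L` and homogeneous in `W` and `s`.
  generalize wzHarmonic n k = L
  generalize wzWeight n k = W
  generalize (-1 : ℝ) ^ n = s
  push_cast
  rw [show 2 * (n : ℝ) + 2 * (k + 1) + 1 = 2 * n + 2 * k + 3 by ring,
    show 2 * ((n : ℝ) + 1) + 2 * k + 1 = 2 * n + 2 * k + 3 by ring,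
    show 2 * ((n : ℝ) + 1) + 4 * k + 3 = 2 * n + 4 * k + 5 by ring]
  field_simp
  ring

lemma sum_wzTerm_sub_sum_wzMate (N K : ℕ) :
    ∑ k ∈ range K, wzMate 0 k =
      ∑ n ∈ range N, wzTerm n 0 - ∑ n ∈ range N, wzTerm n K + ∑ k ∈ range K, wzMate N k := by
  have h1 : ∀ n, ∑ k ∈ range K, (wzTerm n k - wzTerm n (k + 1)) = wzTerm n 0 - wzTerm n K :=
    fun n => sum_range_sub' (fun k => wzTerm n k) K
  have h2 : ∀ k, ∑ n ∈ range N, (wzMate n k - wzMate (n + 1) k) = wzMate 0 k - wzMate N k :=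
    fun k => sum_range_sub' (fun n => wzMate n k) N
  have h3 : ∑ n ∈ range N, (wzTerm n 0 - wzTerm n K) =
      ∑ k ∈ range K, (wzMate 0 k - wzMate N k) := by
    simp only [← h1, ← h2, wzTerm_sub_wzTerm]
    exact sum_comm
  rw [sum_sub_distrib, sum_sub_distrib] at h3
  linarith

/-! ### Bounds and vanishing of the far sides -/

lemma wzWeight_zero_right (n : ℕ) : wzWeight n 0 = 1 / (2 * n + 1) := by
  induction n with
  | zero => simp [wzWeight, halfPoch, threeHalvesPoch]
  | succ n ih =>
    rw [wzWeight_succ_left, ih]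
    push_cast
    field_simp
    ring

/-- The ratio in `k` slightly exceeds 1/4 when `n = 0`; 1/2 is a convenient uniform bound. -/
lemma wzWeight_le (n k : ℕ) : wzWeight n k ≤ (1 / 2) ^ k / (2 * n + 1) := by
  induction k with
  | zero => simp [wzWeight_zero_right]
  | succ k ih =>
    have h : 4 * ((k : ℝ) + 1) ^ 2 / ((2 * n + 4 * k + 3) * (2 * n + 4 * k + 5)) ≤ 1 / 2 := by
      rw [div_le_iff₀ (by positivity)]
      have : (0 : ℝ) ≤ n * k := by positivity
      nlinarith [sq_nonneg (n : ℝ), sq_nonneg (k : ℝ), Nat.cast_nonneg (α := ℝ) n,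
        Nat.cast_nonneg (α := ℝ) k]
    rw [wzWeight_succ_right]
    calc _ ≤ (1 / 2) ^ k / (2 * (n : ℝ) + 1) * (1 / 2) := by gcongr
      _ = _ := by ring

lemma oddHarmonic_add_le (n m : ℕ) : oddHarmonic (n + m) ≤ oddHarmonic n + m := by
  induction m with
  | zero => simp
  | succ m ih =>
    rw [← add_assoc, oddHarmonic_succ]
    have : 1 / (2 * ((n + m : ℕ) : ℝ) + 1) ≤ 1 := by
      rw [div_le_one (by positivity)]
      linarith [Nat.cast_nonneg (α := ℝ) (n + m)]
    push_cast at this ⊢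
    linarith

lemma harmonic_cast_le (k : ℕ) : ((harmonic k : ℚ) : ℝ) ≤ k := by
  induction k with
  | zero => simp
  | succ k ih =>
    have : ((k : ℝ) + 1)⁻¹ ≤ 1 := inv_le_one_of_one_le₀ (by linarith [Nat.cast_nonneg (α := ℝ) k])
    rw [harmonic_succ]
    push_cast
    linarith

lemma wzHarmonic_nonneg (n k : ℕ) : 0 ≤ wzHarmonic n k := by
  have h1 : oddHarmonic n ≤ oddHarmonic (n + k + 1) :=
    sum_le_sum_of_subset_of_nonneg (range_subset_range.2 (by omega))
      fun _ _ _ => by positivity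
  have h2 : (0 : ℝ) ≤ ((harmonic k : ℚ) : ℝ) := by
    rw [harmonic]
    push_cast
    positivity
  unfold wzHarmonic
  linarith

lemma wzHarmonic_le (n k : ℕ) : wzHarmonic n k ≤ 5 * (k + 1) := by
  have h1 := oddHarmonic_add_le n (k + 1)
  have h2 := harmonic_cast_le k
  rw [← add_assoc] at h1
  push_cast at h1
  unfold wzHarmonic
  linarith

lemma abs_wzTerm_le (n k : ℕ) :
    |wzTerm n k| ≤ 5 * (k + 1) * (1 / 2) ^ k / (2 * n + 1) ^ 2 := by
  rw [wzTerm, abs_mul, abs_div, abs_mul, abs_pow, abs_neg, abs_one, one_pow, one_mul,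
    abs_of_nonneg (wzHarmonic_nonneg n k), abs_of_pos (wzWeight_pos n k),
    abs_of_nonneg (by positivity : (0 : ℝ) ≤ 2 * n + 2 * k + 1)]
  calc _ ≤ (1 / 2) ^ k / (2 * (n : ℝ) + 1) / (2 * n + 1) * (5 * (k + 1)) := by
        gcongr
        · exact wzHarmonic_nonneg n k
        · exact wzWeight_le n k
        · linarith [Nat.cast_nonneg (α := ℝ) k]
        · exact wzHarmonic_le n k
    _ = _ := by field_simp

/-- Uniform in `k`, so that N terms at `n = N` add up to O(1/N). -/
lemma abs_wzMate_le (n k : ℕ) : |wzMate n k| ≤ 5 / (2 * n + 1) ^ 2 := by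
  have h0 : 0 ≤ wzRatio n k := by unfold wzRatio; positivity
  have h1 : wzRatio n k ≤ 1 := by
    rw [wzRatio, div_le_one (by positivity)]
    linarith [Nat.cast_nonneg (α := ℝ) k, Nat.cast_nonneg (α := ℝ) n]
  have h2 : ((k : ℝ) + 1) * (1 / 2) ^ k ≤ 1 := by
    have : ((k + 1 : ℕ) : ℝ) ≤ (2 : ℝ) ^ k := by exact_mod_cast Nat.lt_two_pow_self
    rw [one_div, inv_pow, ← div_eq_mul_inv, div_le_one (by positivity)]
    exact_mod_cast this
  rw [wzMate, abs_mul, abs_of_nonneg h0]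
  calc _ ≤ 1 * (5 * (k + 1) * (1 / 2) ^ k / (2 * (n : ℝ) + 1) ^ 2) :=
        mul_le_mul h1 (abs_wzTerm_le n k) (abs_nonneg _) zero_le_one
    _ = 5 * (((k : ℝ) + 1) * (1 / 2) ^ k) / (2 * (n : ℝ) + 1) ^ 2 := by ring
    _ ≤ 5 * 1 / (2 * (n : ℝ) + 1) ^ 2 := by gcongr
    _ = _ := by ring

lemma tendsto_sum_wzTerm_diagonal :
    Tendsto (fun N => ∑ n ∈ range N, wzTerm n N) atTop (𝓝 0) := by
  have hb : ∀ N : ℕ, ‖∑ n ∈ range N, wzTerm n N‖ ≤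
      5 * ((N : ℝ) ^ 2 * (1 / 2) ^ N + (N : ℝ) ^ 1 * (1 / 2) ^ N) := by
    intro N
    refine (norm_sum_le _ _).trans ?_
    have : ∀ n ∈ range N, ‖wzTerm n N‖ ≤ 5 * (N + 1) * (1 / 2) ^ N := by
      intro n _
      refine (abs_wzTerm_le n N).trans (div_le_self (by positivity) ?_)
      nlinarith [Nat.cast_nonneg (α := ℝ) n]
    refine (sum_le_card_nsmul _ _ _ this).trans (le_of_eq ?_)
    rw [card_range, nsmul_eq_mul]
    ring
  refine squeeze_zero_norm hb ?_
  have h := fun j : ℕ => tendsto_pow_const_mul_const_pow_of_abs_lt_one j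
    (show |(1 / 2 : ℝ)| < 1 by rw [abs_of_pos] <;> norm_num)
  simpa using ((h 2).add (h 1)).const_mul 5

lemma tendsto_sum_wzMate_diagonal :
    Tendsto (fun N => ∑ k ∈ range N, wzMate N k) atTop (𝓝 0) := by
  have hb : ∀ N : ℕ, ‖∑ k ∈ range N, wzMate N k‖ ≤ 5 * (1 / ((N : ℝ) + 1)) := by
    intro N
    refine (norm_sum_le _ _).trans ?_
    refine (sum_le_card_nsmul _ _ _ fun k _ => abs_wzMate_le N k).trans ?_
    rw [card_range, nsmul_eq_mul, mul_div_assoc', mul_one_div,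
      div_le_div_iff₀ (by positivity) (by positivity)]
    nlinarith [Nat.cast_nonneg (α := ℝ) N, sq_nonneg (N : ℝ)]
  refine squeeze_zero_norm hb ?_
  simpa using (tendsto_one_div_add_atTop_nhds_zero_nat (𝕜 := ℝ)).const_mul 5

/-! ### Evaluation of the series -/

/-- The value at `3` of the Dirichlet beta function. -/
lemma hasSum_dirichletBeta_three :
    HasSum (fun n : ℕ => (-1 : ℝ) ^ n / (2 * n + 1) ^ 3) (Real.pi ^ 3 / 32) := by
  -- Fourier series of the Bernoulli polynomial B₃ at 1/4: sin(πm/2) vanishes at even m and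
  -- alternates in sign over odd m.
  have h := hasSum_one_div_nat_pow_mul_sin one_ne_zero
    (show (1 / 4 : ℝ) ∈ Set.Icc (0 : ℝ) 1 by constructor <;> norm_num)
  have hinj : Function.Injective fun n : ℕ => 2 * n + 1 := fun a b hab => by
    simp only at hab
    omega
  rw [← hinj.hasSum_iff] at h
  · convert h using 1
    · funext n
      have : Real.sin (2 * Real.pi * ((2 * n + 1 : ℕ) : ℝ) * (1 / 4)) = (-1) ^ n := by
        rw [show 2 * Real.pi * ((2 * n + 1 : ℕ) : ℝ) * (1 / 4) = Real.pi / 2 + n * Real.pi by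
          push_cast; ring, Real.sin_add_nat_mul_pi]
        simp
      simp only [Function.comp_apply]
      rw [this]
      push_cast
      ring
    · have : Polynomial.eval (1 / 4 : ℝ)
          (Polynomial.map (algebraMap ℚ ℝ) (Polynomial.bernoulli 3)) = 3 / 64 := by
        simp [Polynomial.bernoulli, sum_range_succ, bernoulli_eq_bernoulli'_of_ne_one,
          Nat.choose, Polynomial.eval_add]
        norm_num
      norm_num at this ⊢
      rw [this]
      ring
  · intro m hm
    rcases Nat.even_or_odd' m with ⟨j, rfl | rfl⟩
    · rw [show 2 * Real.pi * ((2 * j : ℕ) : ℝ) * (1 / 4) = j * Real.pi by push_cast; ring,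
        Real.sin_nat_mul_pi, mul_zero]
    · exact absurd ⟨j, rfl⟩ hm

lemma wzTerm_zero_right (n : ℕ) : wzTerm n 0 = 4 * ((-1) ^ n / (2 * n + 1) ^ 3) := by
  rw [wzTerm, wzWeight_zero_right, wzHarmonic, add_zero, oddHarmonic_succ]
  simp
  field_simp

lemma wzMate_zero_left_nonneg (k : ℕ) : 0 ≤ wzMate 0 k := by
  have := (wzWeight_pos 0 k).le
  have := wzHarmonic_nonneg 0 k
  unfold wzMate wzRatio wzTerm
  positivity

lemma hasSum_wzMate_zero : HasSum (fun k => wzMate 0 k) (Real.pi ^ 3 / 8) := by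
  -- By nonnegativity, the limit along the squares `K = N` suffices.
  rw [hasSum_iff_tendsto_nat_of_nonneg wzMate_zero_left_nonneg]
  have h := (hasSum_dirichletBeta_three.mul_left 4).tendsto_sum_nat
  simp only [← wzTerm_zero_right] at h
  have h' := (h.sub tendsto_sum_wzTerm_diagonal).add tendsto_sum_wzMate_diagonal
  simp only [← sum_wzTerm_sub_sum_wzMate] at h'
  convert h' using 2
  ring

/-! ### Translation to binomials and harmonic numbers -/

lemma centralBinom_mul_factorial (n : ℕ) :
    (n.centralBinom : ℝ) * n.factorial = 4 ^ n * halfPoch n := by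
  induction n with
  | zero => simp [halfPoch]
  | succ n ih =>
    have h : ((n : ℝ) + 1) * (n + 1).centralBinom = 2 * (2 * n + 1) * n.centralBinom := by
      exact_mod_cast Nat.succ_mul_centralBinom_succ n
    rw [Nat.factorial_succ, halfPoch_succ]
    push_cast
    linear_combination (n.factorial : ℝ) * h + 2 * (2 * (n : ℝ) + 1) * ih

lemma factorial_two_mul_eq (n : ℕ) :
    ((2 * n).factorial : ℝ) = 4 ^ n * n.factorial * halfPoch n := by
  have h : (n.centralBinom : ℝ) * n.factorial * n.factorial = (2 * n).factorial := by
    have := Nat.choose_mul_factorial_mul_factorial (show n ≤ 2 * n by omega)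
    rw [show 2 * n - n = n by omega] at this
    exact_mod_cast this
  rw [← h, centralBinom_mul_factorial]
  ring

lemma centralBinom_mul_centralBinom_two_mul (n : ℕ) :
    (n.centralBinom : ℝ) * (2 * n).centralBinom * (n.factorial : ℝ) ^ 2 =
      16 ^ n * halfPoch (2 * n) := by
  have h1 := centralBinom_mul_factorial n
  have h2 := centralBinom_mul_factorial (2 * n)
  have h3 := factorial_two_mul_eq n
  have hp := (halfPoch_pos n).ne'
  have h4 : (4 : ℝ) ^ (2 * n) = 16 ^ n := by rw [pow_mul]; norm_num
  rw [h3, h4] at h2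
  have h5 : (4 : ℝ) ^ n * halfPoch n ≠ 0 := by positivity
  apply mul_left_cancel₀ h5
  linear_combination ((2 * n).centralBinom : ℝ) * n.factorial * (4 ^ n * halfPoch n) * h1
    + 4 ^ n * halfPoch n * h2

/-- Splits the sum into odd and even denominators. -/
lemma harmonic_two_mul_succ (n : ℕ) :
    ((harmonic (2 * n + 1) : ℚ) : ℝ) = oddHarmonic (n + 1) + ((harmonic n : ℚ) : ℝ) / 2 := by
  induction n with
  | zero => simp [oddHarmonic]
  | succ n ih =>
    rw [show 2 * (n + 1) + 1 = 2 * n + 1 + 1 + 1 by ring, harmonic_succ, harmonic_succ (2 * n + 1),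
      harmonic_succ n, oddHarmonic_succ]
    push_cast
    rw [ih]
    field_simp
    ring

theorem theorem1p4 :
    HasSum
      (fun k : ℕ+ =>
        (16 : ℝ) ^ (k : ℕ) * (6 * ((k : ℕ) : ℝ) - 1) *
            (4 * ((harmonic (2 * (k : ℕ) - 1) : ℚ) : ℝ) - ((harmonic ((k : ℕ) - 1) : ℚ) : ℝ)) /
          ((2 * ((k : ℕ) : ℝ) - 1) * ((k : ℕ) : ℝ) ^ 2 *
            (Nat.choose (2 * (k : ℕ)) (k : ℕ) : ℝ) *
            (Nat.choose (4 * (k : ℕ)) (2 * (k : ℕ)) : ℝ)))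
      (Real.pi ^ 3) := by
  rw [← Equiv.pnatEquivNat.symm.hasSum_iff]
  have h := hasSum_wzMate_zero.mul_left 8
  rw [show 8 * (Real.pi ^ 3 / 8) = Real.pi ^ 3 by ring] at h
  refine Eq.mpr (congrArg (fun f : ℕ → ℝ => HasSum f (Real.pi ^ 3)) (funext fun k => ?_)) h
  have hc := centralBinom_mul_centralBinom_two_mul (k + 1)
  have hp := threeHalvesPoch_pos (2 * k)
  have hb1 : ((k + 1).centralBinom : ℝ) ≠ 0 := by exact_mod_cast Nat.centralBinom_ne_zero _
  have hb2 : ((2 * (k + 1)).centralBinom : ℝ) ≠ 0 := by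
    exact_mod_cast Nat.centralBinom_ne_zero _
  have hk : (k.factorial : ℝ) ≠ 0 := by positivity
  rw [show 2 * (k + 1) = 2 * k + 1 + 1 by ring, halfPoch_succ_eq_threeHalvesPoch,
    threeHalvesPoch_succ, show 2 * k + 1 + 1 = 2 * (k + 1) by ring, Nat.factorial_succ] at hc
  have hd : (16 : ℝ) ^ (k + 1) / (((k + 1).centralBinom : ℝ) * (2 * (k + 1)).centralBinom) =
      2 * ((k + 1) * k.factorial) ^ 2 / (threeHalvesPoch (2 * k) * (2 * k + 3 / 2)) := by
    rw [div_eq_div_iff (by positivity) (by positivity)]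
    push_cast at hc
    linear_combination -2 * hc
  have hL : 4 * ((harmonic (2 * k + 1) : ℚ) : ℝ) - ((harmonic k : ℚ) : ℝ) = wzHarmonic 0 k := by
    rw [harmonic_two_mul_succ, wzHarmonic]
    simp [oddHarmonic]
    ring
  have hcast : ((Equiv.pnatEquivNat.symm k : ℕ+) : ℕ) = k + 1 := rfl
  simp only [Function.comp_apply, hcast]
  rw [show 2 * (k + 1) - 1 = 2 * k + 1 by omega, show k + 1 - 1 = k by omega, hL,
    show 4 * (k + 1) = 2 * (2 * (k + 1)) by ring, ← Nat.centralBinom_eq_two_mul_choose,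
    ← Nat.centralBinom_eq_two_mul_choose]
  calc _ = (16 : ℝ) ^ (k + 1) / (((k + 1).centralBinom : ℝ) * (2 * (k + 1)).centralBinom) *
        ((6 * ((k + 1 : ℕ) : ℝ) - 1) * wzHarmonic 0 k /
          ((2 * ((k + 1 : ℕ) : ℝ) - 1) * ((k + 1 : ℕ) : ℝ) ^ 2)) := by
        rw [div_mul_div_comm]
        congr 1 <;> ring
    _ = _ := by
        rw [hd, wzMate, wzRatio, wzTerm, wzWeight]
        generalize wzHarmonic 0 k = L
        have h1 : 2 * ((k + 1 : ℕ) : ℝ) - 1 = 2 * k + 1 := by push_cast; ring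
        rw [h1, zero_add]
        simp only [halfPoch, range_zero, prod_empty]
        push_cast
        field_simp
        ring
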